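/- Consider a single server of unit capacity shared by $K$ classes of jobs. Jobs of class $i$ ($i=1,\dots,K$) arrive according to independent Poisson processes with rates $\lambda_i>0$, and all jobs have independent exponentially distributed service requirements with mean $1/\mu$, where $\mu>0$ and $\rho=\sum_{i=1}^K\lambda_i/\mu<1$. The server follows the discriminatory processor sharing (DPS) policy: each job has a priority level, all jobs of class $i$ have priority level $\beta_i>0$, and whenever jobs with priority levels $b_1,\dots,b_N$ are present, job $\ell$ receives the fraction $b_\ell/\sum_{m=1}^N b_m$ of the capacity. Thus the vector of the numbers of jobs of each class is a continuous-time Markov chain. Let $N_i$ be the steady-state number of class $i$ jobs, let $\boldsymbol\beta=(\beta_1,\dots,\beta_K)$, and let $V(\beta;\boldsymbol\beta)$ be the expected processing time (time from arrival to completion) of a single job with priority level $\beta>0$ that arrives to the system in steady state and shares the server with the other jobs under the DPS policy. Then $\mu-\sum_{i=1}^K\frac{\lambda_i\beta_i}{\beta_i+\beta}>0$, the expectations $\mathbf E[N_i]$ and $V(\beta;\boldsymbol\beta)$ are finite, and $$V(\beta;\boldsymbol\beta)=U_0(\beta;\boldsymbol\beta)+\sum_{i=1}^K U_i(\beta;\boldsymbol\beta)\,\mathbf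 E[N_i],$$ where $$U_0(\beta;\boldsymbol\beta)=\Bigl[\mu-\sum_{i=1}^K\frac{\lambda_i\beta_i}{\beta_i+\beta}\Bigr]^{-1},\qquad U_i(\beta;\boldsymbol\beta)=\frac{\beta_i}{\beta_i+\beta}\,U_0(\beta;\boldsymbol\beta),\quad i=1,\dots,K.$$ -/

import Mathlib

open MeasureTheory ProbabilityTheory
open scoped ENNReal

namespace DPS

/-! ### The discriminatory processor sharing (DPS) queue

The classes are indexed by a finite type `ι`. Jobs of class `i` arrive according to a Poisson
process of rate `lam i`, every job has an exponentially distributed service requirement with mean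
`1 / mu`, and every job of class `i` has priority level `b i`. The server has unit capacity. The
state of the system is the vector `n` of the numbers of jobs present, and the evolution is that of
a continuous-time Markov chain on `ι → ℕ`. -/

section Model

variable {ι : Type*} [Fintype ι] [DecidableEq ι]

/-- The fraction of the service capacity allocated to each single job of class `i` when the
system is in state `n`: its priority level over the sum of the priority levels of all jobs
present. -/
noncomputable def share (b : ι → ℝ) (n : ι → ℕ) (i : ι) : ℝ :=
  b i / ∑ j, (n j : ℝ) * b j

/-- The events that change the state: an arrival or a departure of a job of a given class. -/
inductive Event (ι : Type*)
  | arrival (i : ι)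
  | departure (i : ι)
  deriving DecidableEq, Fintype

/-- The state after an event. (Departures from an empty class have rate `0`.) -/
def Event.next (n : ι → ℕ) : Event ι → (ι → ℕ)
  | .arrival i => Function.update n i (n i + 1)
  | .departure i => Function.update n i (n i - 1)

/-- The rate at which an event occurs in state `n`: arrivals of class `i` at rate `lam i`, and each
of the `n i` jobs of class `i` is completed at rate `mu` times the fraction of the capacity that
it receives. -/
noncomputable def Event.rate (lam b : ι → ℝ) (mu : ℝ) (n : ι → ℕ) : Event ι → ℝ≥0∞
  | .arrival i => ENNReal.ofReal (lam i)
  | .departure i => ENNReal.ofReal ((n i : ℝ) * (mu * share b n i))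

/-- The total rate of events in state `n`. -/
noncomputable def totalRate (lam b : ι → ℝ) (mu : ℝ) (n : ι → ℕ) : ℝ≥0∞ :=
  ∑ e : Event ι, e.rate lam b mu n

/-- The transition rate from state `n` to state `m`. -/
noncomputable def transRate (lam b : ι → ℝ) (mu : ℝ) (n m : ι → ℕ) : ℝ≥0∞ :=
  ∑ e : Event ι, if e.next n = m then e.rate lam b mu n else 0

/-- `π` is a steady-state distribution of the DPS system: a probability distribution on the states
which satisfies the global balance equations, that is, for every state `m` the flow of
probability into `m` equals the flow out of `m`. -/
def IsSteadyState (lam b : ι → ℝ) (mu : ℝ) (π : PMF (ι → ℕ)) : Prop :=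
  ∀ m : ι → ℕ, ∑' n, π n * transRate lam b mu n m = π m * totalRate lam b mu m

/-- The expectation of the number of class `i` jobs under the distribution `π` of the state. -/
noncomputable def meanNumber (π : PMF (ι → ℕ)) (i : ι) : ℝ≥0∞ :=
  ∑' n : ι → ℕ, π n * (n i : ℝ≥0∞)

/-! #### Sample paths: jump chain and holding times -/

/-- The law of the state after the next event, when the system is in state `n`: event `e` is the
next one with probability proportional to its rate (if no event is possible, the system stays
in `n`). -/
noncomputable def stepLaw (lam b : ι → ℝ) (mu : ℝ) (n : ι → ℕ) : Measure (ι → ℕ) :=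
  if totalRate lam b mu n = 0 then Measure.dirac n
  else ∑ e : Event ι, (e.rate lam b mu n / totalRate lam b mu n) • Measure.dirac (e.next n)

/-- The transition kernel of the jump chain. -/
noncomputable def stepKernel (lam b : ι → ℝ) (mu : ℝ) : Kernel (ι → ℕ) (ι → ℕ) :=
  Kernel.ofFunOfCountable (stepLaw lam b mu)

instance (lam b : ι → ℝ) (mu : ℝ) : IsMarkovKernel (stepKernel lam b mu) where
  isProbabilityMeasure n := by
    have htop : totalRate lam b mu n ≠ ∞ :=
      ENNReal.sum_ne_top.2 fun e _ => by cases e <;> exact ENNReal.ofReal_ne_top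
    change IsProbabilityMeasure (stepLaw lam b mu n)
    by_cases h : totalRate lam b mu n = 0
    · rw [stepLaw, if_pos h]; infer_instance
    · rw [stepLaw, if_neg h]
      refine ⟨?_⟩
      simp only [Measure.coe_finsetSum, Finset.sum_apply, Measure.smul_apply, measure_univ,
        smul_eq_mul, mul_one, div_eq_mul_inv]
      rw [← Finset.sum_mul]
      exact ENNReal.mul_inv_cancel h htop

instance : IsProbabilityMeasure (expMeasure 1) := isProbabilityMeasure_expMeasure one_pos

/-- The law of the sequence `Y 0, Y 1, Y 2, …` of the successive states of the system (the jump
chain, a discrete-time Markov chain), when `Y 0` has law `init`. -/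
noncomputable def jumpChainLaw (lam b : ι → ℝ) (mu : ℝ) (init : Measure (ι → ℕ)) :
    Measure (ℕ → ι → ℕ) :=
  Kernel.trajMeasure (X := fun _ => ι → ℕ) init fun k =>
    (stepKernel lam b mu).comap (fun x => x ⟨k, Finset.mem_Iic.2 le_rfl⟩) (measurable_pi_apply _)

/-- The law of the DPS system started from `init`: the jump chain `Y` together with an independent
sequence `E 0, E 1, …` of independent exponential random variables with mean `1`. -/
noncomputable def pathLaw (lam b : ι → ℝ) (mu : ℝ) (init : Measure (ι → ℕ)) :
    Measure ((ℕ → ι → ℕ) × (ℕ → ℝ)) :=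
  (jumpChainLaw lam b mu init).prod (Measure.infinitePi fun _ : ℕ => expMeasure 1)

/-- The time of the `k`-th event: the chain stays in the state `Y j` for the time
`E j / totalRate (Y j)`, an exponential random variable with parameter `totalRate (Y j)`
(infinite if the state is absorbing). -/
noncomputable def eventTime (lam b : ι → ℝ) (mu : ℝ) (ω : (ℕ → ι → ℕ) × (ℕ → ℝ)) (k : ℕ) : ℝ≥0∞ :=
  ∑ j ∈ Finset.range k, ENNReal.ofReal (ω.2 j) / totalRate lam b mu (ω.1 j)

/-- The first time at which no job of class `i` is present (`∞` if there is no such time). -/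
noncomputable def emptyTime (lam b : ι → ℝ) (mu : ℝ) (i : ι) (ω : (ℕ → ι → ℕ) × (ℕ → ℝ)) : ℝ≥0∞ :=
  ⨅ (k : ℕ) (_ : ω.1 k i = 0), eventTime lam b mu ω k

end Model

/-! ### A tagged job -/

section Tagged

variable {ι : Type*} [Fintype ι] [DecidableEq ι]

/-- The arrival rates when one more class `none` is added, to hold a single tagged job: there are
no further arrivals of class `none`. -/
def taggedRates (lam : ι → ℝ) : Option ι → ℝ
  | none => 0
  | some i => lam i

/-- The priority levels when the tagged job has priority level `β`. -/
def taggedPrio (b : ι → ℝ) (β : ℝ) : Option ι → ℝ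
  | none => β
  | some i => b i

/-- The state in which the tagged job shares the server with `n i` jobs of class `i`. -/
def taggedState (n : ι → ℕ) : Option ι → ℕ
  | none => 1
  | some i => n i

/-- The expected processing time (time between arrival and completion) of a job with priority
level `β` that arrives when the state of the system has distribution `π`. -/
noncomputable def expectedProcessingTime (lam b : ι → ℝ) (mu : ℝ) (π : PMF (ι → ℕ)) (β : ℝ) :
    ℝ≥0∞ :=
  ∫⁻ ω, emptyTime (taggedRates lam) (taggedPrio b β) mu none ω
    ∂(pathLaw (taggedRates lam) (taggedPrio b β) mu (π.map taggedState).toMeasure)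

end Tagged

/-- The coefficient `U₀(β; 𝛃)`. -/
noncomputable def U₀ {ι : Type*} [Fintype ι] (lam b : ι → ℝ) (mu β : ℝ) : ℝ :=
  (mu - ∑ i, lam i * b i / (b i + β))⁻¹

/-- The coefficient `U_i(β; 𝛃)`. -/
noncomputable def U {ι : Type*} [Fintype ι] (lam b : ι → ℝ) (mu β : ℝ) (i : ι) : ℝ :=
  b i / (b i + β) * U₀ lam b mu β

end DPS

namespace DPS

/-! While the tagged job is present the server is busy, so events occur at the constant rate `Λ +
μ`, where `Λ = ∑ λ_i`. Let `Q` be one step of the jump chain killed when the tagged job leaves.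
Summing the mean holding times over the steps survived, the expected remaining time is the potential
`∑ Q^k (1/(Λ+μ))` (`lintegral_emptyTime`).

First-step analysis suggests solving `T = Q T + 1/(Λ+μ)`, and the affine function `T(n) = U₀ + ∑ U_i
n_i` does so (`conditionalTime_eq`). A solution is a priori only an upper bound for the potential. A
quadratic Lyapunov function (`exists_lyapunov`) makes `∑ Q^k T` finite, so `Q^k T → 0` and the
iterated equation leaves no remainder (`tsum_iterate_eq_of_lyapunov`).

Since `T` is affine, averaging over the initial state involves only the means `E[N_i]`. These are
finite because the total number of jobs evolves as an M/M/1 queue, whose stationary tail is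
geometric (`IsSteadyState.tailProb_eq`). -/

theorem lintegral_ofReal_expMeasure_one : ∫⁻ x, ENNReal.ofReal x ∂(expMeasure 1) = 1 := by
  have hm (a : ℝ) : Measurable (gammaPDF a 1) := (measurable_gammaPDFReal a 1).ennreal_ofReal
  -- `x` times the exponential density is the Gamma(2, 1) density, which has total mass one.
  rw [expMeasure, gammaMeasure, lintegral_withDensity_eq_lintegral_mul _ (hm 1) (by fun_prop),
    ← lintegral_gammaPDF_eq_one (a := 2) (r := 1) (by norm_num) one_pos]
  refine lintegral_congr fun x => ?_
  simp only [Pi.mul_apply, gammaPDF, gammaPDFReal]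
  by_cases hx : 0 ≤ x
  · rw [if_pos hx, if_pos hx, ← ENNReal.ofReal_mul (by simp; positivity)]
    congr 1
    have : (2 : ℝ) - 1 = 1 := by norm_num
    simp [this]
    ring
  · rw [if_neg hx, if_neg hx]
    simp

/-! ### Expected emptying time as a potential of the killed jump chain -/

section Path

variable {σ : Type*}

/-- The indicator of the event that class `i` is nonempty in the first `k + 1` states of `x`. -/
noncomputable def survival (i : σ) (k : ℕ) (x : ℕ → σ → ℕ) : ℝ≥0∞ :=
  ∏ j ∈ Finset.Iic k, {n : σ → ℕ | n i ≠ 0}.indicator 1 (x j)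

theorem survival_succ (i : σ) (k : ℕ) (x : ℕ → σ → ℕ) :
    survival i (k + 1) x =
      survival i k x * {n : σ → ℕ | n i ≠ 0}.indicator 1 (x (k + 1)) := by
  rw [survival, survival, ← Nat.range_succ_eq_Iic, Finset.prod_range_succ, Nat.range_succ_eq_Iic]

theorem survival_eq_one {i : σ} {k : ℕ} {x : ℕ → σ → ℕ} (h : ∀ j ≤ k, x j i ≠ 0) :
    survival i k x = 1 :=
  Finset.prod_eq_one fun j hj => by simp [h j (Finset.mem_Iic.1 hj)]

theorem survival_eq_zero {i : σ} {j k : ℕ} {x : ℕ → σ → ℕ} (hj : j ≤ k) (h : x j i = 0) :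
    survival i k x = 0 :=
  Finset.prod_eq_zero (Finset.mem_Iic.2 hj) (by simp [h])

theorem measurable_survival [Finite σ] (i : σ) (k : ℕ) : Measurable (survival i k) := by
  refine Finset.measurable_fun_prod _ fun j _ => ?_
  exact (Measurable.of_discrete (f := {n : σ → ℕ | n i ≠ 0}.indicator (1 : (σ → ℕ) → ℝ≥0∞))).comp
    (measurable_pi_apply j)

/-- The survival factors cut the series at the first index with class `i` empty. Such an index must
exist: otherwise `emptyTime` is `∞`, while the holding times could still have a finite sum. -/
theorem tsum_survival_mul_eq_emptyTime [Fintype σ] (lam b : σ → ℝ) (mu : ℝ) (i : σ)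
    (ω : (ℕ → σ → ℕ) × (ℕ → ℝ)) (h : ∃ k, ω.1 k i = 0) :
    ∑' j, survival i j ω.1 * (ENNReal.ofReal (ω.2 j) / totalRate lam b mu (ω.1 j)) =
      emptyTime lam b mu i ω := by
  classical
  have hmono : Monotone (eventTime lam b mu ω) := fun k l hkl =>
    Finset.sum_le_sum_of_subset (Finset.range_mono hkl)
  have hT : emptyTime lam b mu i ω = eventTime lam b mu ω (Nat.find h) :=
    le_antisymm (iInf₂_le (f := fun k (_ : ω.1 k i = 0) => eventTime lam b mu ω k) _
      (Nat.find_spec h))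
      (le_iInf₂ fun k hk => hmono (Nat.find_min' h hk))
  rw [hT, eventTime, tsum_eq_sum (s := Finset.range (Nat.find h))]
  · refine Finset.sum_congr rfl fun j hj => ?_
    rw [survival_eq_one, one_mul]
    exact fun l hl => Nat.find_min h (hl.trans_lt (Finset.mem_range.1 hj))
  · intro j hj
    rw [survival_eq_zero (by simpa using hj) (Nat.find_spec h), zero_mul]

variable [Fintype σ] [DecidableEq σ]

/-- One step of the jump chain, killed when class `i` gets empty, acting on functions. -/
noncomputable def killedStep (lam b : σ → ℝ) (mu : ℝ) (i : σ) (g : (σ → ℕ) → ℝ≥0∞) (n : σ → ℕ) :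
    ℝ≥0∞ :=
  ∫⁻ m, {n : σ → ℕ | n i ≠ 0}.indicator g m ∂(stepKernel lam b mu n)

theorem lintegral_jumpChainLaw_zero (lam b : σ → ℝ) (mu : ℝ) (init : Measure (σ → ℕ))
    (g : (σ → ℕ) → ℝ≥0∞) :
    ∫⁻ x, g (x 0) ∂(jumpChainLaw lam b mu init) = ∫⁻ n, g n ∂init := by
  have hmap : (jumpChainLaw lam b mu init).map (Preorder.frestrictLe (π := fun _ => σ → ℕ) 0) =
      init.map (MeasurableEquiv.piUnique (fun _ : Finset.Iic 0 => σ → ℕ)).symm := by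
    rw [jumpChainLaw, Kernel.trajMeasure, Measure.map_comp _ _ (by fun_prop),
      Kernel.traj_map_frestrictLe, Kernel.partialTraj_self, Measure.id_comp]
  have h0 := congrArg (fun ν => ∫⁻ z, g (z ⟨0, by simp⟩) ∂ν) hmap
  have hg : Measurable g := .of_discrete
  beta_reduce at h0
  rw [lintegral_map (by fun_prop) (by fun_prop), lintegral_map (by fun_prop) (by fun_prop)] at h0
  exact h0

/-- The Markov property, tested against a function `G` of the past. -/
theorem lintegral_jumpChainLaw_succ (lam b : σ → ℝ) (mu : ℝ) (init : Measure (σ → ℕ))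
    [IsProbabilityMeasure init] (k : ℕ) {G : (Finset.Iic k → σ → ℕ) → ℝ≥0∞} (hG : Measurable G)
    (g : (σ → ℕ) → ℝ≥0∞) :
    ∫⁻ x, G (Preorder.frestrictLe (π := fun _ => σ → ℕ) k x) * g (x (k + 1))
        ∂(jumpChainLaw lam b mu init) =
      ∫⁻ x, G (Preorder.frestrictLe (π := fun _ => σ → ℕ) k x) *
        ∫⁻ m, g m ∂(stepKernel lam b mu (x k)) ∂(jumpChainLaw lam b mu init) := by
  have hg : Measurable g := .of_discrete
  have hS : Measurable fun n => ∫⁻ m, g m ∂(stepKernel lam b mu n) := .of_discrete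
  have key := Kernel.map_frestrictLe_trajMeasure_compProd_eq_map_trajMeasure
    (X := fun _ => σ → ℕ) (μ₀ := init)
    (κ := fun k => (stepKernel lam b mu).comap
      (fun x : Finset.Iic k → σ → ℕ => x ⟨k, Finset.mem_Iic.2 le_rfl⟩) (measurable_pi_apply _))
    (a := k)
  change (jumpChainLaw lam b mu init).map _ ⊗ₘ _ = (jumpChainLaw lam b mu init).map _ at key
  have hk := congrArg (fun ν => ∫⁻ z, G z.1 * g z.2 ∂ν) key
  beta_reduce at hk
  rw [lintegral_map (by fun_prop) (by fun_prop)] at hk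
  rw [← hk]
  have hprob : IsProbabilityMeasure ((jumpChainLaw lam b mu init).map
      (Preorder.frestrictLe (π := fun _ => σ → ℕ) k)) := by
    have : IsProbabilityMeasure (jumpChainLaw lam b mu init) := by
      unfold jumpChainLaw; infer_instance
    exact Measure.isProbabilityMeasure_map (by fun_prop)
  rw [Measure.lintegral_compProd (by fun_prop)]
  simp only [Kernel.comap_apply]
  rw [lintegral_map _ (by fun_prop)]
  · refine lintegral_congr fun x => ?_
    rw [lintegral_const_mul _ hg]
    rfl
  · simp_rw [lintegral_const_mul _ hg]
    exact hG.mul (hS.comp (measurable_pi_apply _))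

/-- The Markov property peels off the last step and turns `g` into `killedStep g`. As `killedStep`
kills on the target state only, the condition at time `0` survives as an indicator. -/
theorem lintegral_survival_mul (lam b : σ → ℝ) (mu : ℝ) (init : Measure (σ → ℕ))
    [IsProbabilityMeasure init] (i : σ) (k : ℕ) (g : (σ → ℕ) → ℝ≥0∞) :
    ∫⁻ x, survival i k x * g (x k) ∂(jumpChainLaw lam b mu init) =
      ∫⁻ n, {n : σ → ℕ | n i ≠ 0}.indicator ((killedStep lam b mu i)^[k] g) n ∂init := by
  induction k generalizing g with
  | zero =>
    rw [← lintegral_jumpChainLaw_zero lam b mu init]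
    refine lintegral_congr fun x => ?_
    by_cases h : x 0 i = 0
    · rw [survival_eq_zero le_rfl h]; simp [h]
    · rw [survival_eq_one (by simpa using h)]; simp [h]
  | succ k ih =>
    rw [Function.iterate_succ_apply, ← ih]
    have hs (x : ℕ → σ → ℕ) : survival i k x =
        (fun z : Finset.Iic k → σ → ℕ => ∏ j, {n : σ → ℕ | n i ≠ 0}.indicator 1 (z j))
          (Preorder.frestrictLe (π := fun _ => σ → ℕ) k x) :=
      (Finset.prod_coe_sort (Finset.Iic k)
        fun j => {n : σ → ℕ | n i ≠ 0}.indicator (1 : (σ → ℕ) → ℝ≥0∞) (x j)).symm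
    have hm : Measurable
        (fun z : Finset.Iic k → σ → ℕ =>
          ∏ j, {n : σ → ℕ | n i ≠ 0}.indicator (1 : (σ → ℕ) → ℝ≥0∞) (z j)) := .of_discrete
    have hl (x : ℕ → σ → ℕ) : survival i (k + 1) x * g (x (k + 1)) =
        survival i k x * {n : σ → ℕ | n i ≠ 0}.indicator g (x (k + 1)) := by
      rw [survival_succ, mul_assoc]
      by_cases h : x (k + 1) i = 0 <;> simp [h]
    simp_rw [hl, hs]
    rw [lintegral_jumpChainLaw_succ lam b mu init k hm]
    rfl

instance (lam b : σ → ℝ) (mu : ℝ) (init : Measure (σ → ℕ)) [IsProbabilityMeasure init] :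
    IsProbabilityMeasure (jumpChainLaw lam b mu init) := by
  unfold jumpChainLaw; infer_instance

theorem lintegral_emptyTime (lam b : σ → ℝ) (mu : ℝ) (init : Measure (σ → ℕ))
    [IsProbabilityMeasure init] (i : σ) {R : ℝ≥0∞} (hR0 : R ≠ 0) (hR : R ≠ ∞)
    (hrate : ∀ n, totalRate lam b mu n ≤ R)
    (hfin : ∑' k, ∫⁻ n, {n : σ → ℕ | n i ≠ 0}.indicator
      ((killedStep lam b mu i)^[k] fun n => (totalRate lam b mu n)⁻¹) n ∂init ≠ ∞) :
    ∫⁻ ω, emptyTime lam b mu i ω ∂(pathLaw lam b mu init) =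
      ∑' k, ∫⁻ n, {n : σ → ℕ | n i ≠ 0}.indicator
        ((killedStep lam b mu i)^[k] fun n => (totalRate lam b mu n)⁻¹) n ∂init := by
  simp_rw [← lintegral_survival_mul lam b mu init i] at hfin ⊢
  have hrm : Measurable fun n => (totalRate lam b mu n)⁻¹ := .of_discrete
  have hsm := measurable_survival i
  -- On paths that never empty, `R` times each integrand is at least `1`. By Markov's inequality
  -- their probability is at most `R` times the `k`-th term of a convergent series, for every `k`.
  have hae : ∀ᵐ x ∂(jumpChainLaw lam b mu init), ∃ k, x k i = 0 := by
    have hle (k : ℕ) : jumpChainLaw lam b mu init {x | ¬ ∃ k, x k i = 0} ≤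
        R * ∫⁻ x, survival i k x * (totalRate lam b mu (x k))⁻¹ ∂(jumpChainLaw lam b mu init) := by
      rw [← lintegral_const_mul _ (by fun_prop)]
      refine (measure_mono ?_).trans (meas_ge_le_lintegral_div (f := fun x =>
        R * (survival i k x * (totalRate lam b mu (x k))⁻¹)) (by fun_prop) one_ne_zero
          ENNReal.one_ne_top |>.trans_eq (by simp))
      intro x hx
      simp only [not_exists, Set.mem_ofPred_eq] at hx ⊢
      rw [survival_eq_one fun j _ => hx j, one_mul]
      rw [← div_eq_mul_inv, ENNReal.le_div_iff_mul_le (Or.inr hR0) (Or.inr hR), one_mul]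
      exact hrate _
    have hlim := ENNReal.Tendsto.const_mul (a := R) (ENNReal.tendsto_atTop_zero_of_tsum_ne_top hfin)
      (Or.inr hR)
    rw [mul_zero] at hlim
    exact le_antisymm (ge_of_tendsto' hlim hle) zero_le
  have hae' : ∀ᵐ ω ∂(pathLaw lam b mu init), ∃ k, ω.1 k i = 0 :=
    Measure.quasiMeasurePreserving_fst.ae hae
  rw [← lintegral_congr_ae (hae'.mono fun ω hω => tsum_survival_mul_eq_emptyTime lam b mu i ω hω)]
  rw [lintegral_tsum]
  · refine tsum_congr fun k => ?_
    rw [pathLaw]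
    have he (ω : (ℕ → σ → ℕ) × (ℕ → ℝ)) :
        survival i k ω.1 * (ENNReal.ofReal (ω.2 k) / totalRate lam b mu (ω.1 k)) =
        (fun x : ℕ → σ → ℕ => survival i k x * (totalRate lam b mu (x k))⁻¹) ω.1 *
          (fun y : ℕ → ℝ => ENNReal.ofReal (y k)) ω.2 := by
      simp only [div_eq_mul_inv]; ring
    simp_rw [he]
    rw [lintegral_prod_mul (f := fun x => survival i k x * (totalRate lam b mu (x k))⁻¹)
      (g := fun y : ℕ → ℝ => ENNReal.ofReal (y k)) (by fun_prop)
      (Measurable.aemeasurable (by fun_prop))]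
    have hk := lintegral_map (μ := Measure.infinitePi fun _ : ℕ => expMeasure 1)
      ENNReal.measurable_ofReal (measurable_pi_apply k)
    rw [Measure.infinitePi_map_eval, lintegral_ofReal_expMeasure_one] at hk
    rw [← hk, mul_one]
  · intro k
    simp_rw [div_eq_mul_inv]
    fun_prop

end Path

/-- Let `Q` be an additive operator on functions and `F` a solution of `Q F + c = F`. If there is a
finite function `H` with `Q H + F ≤ H`, then `F` is the potential of `c`. -/
theorem tsum_iterate_eq_of_lyapunov {α : Type*} {Q : (α → ℝ≥0∞) → α → ℝ≥0∞}
    (hadd : ∀ u v, Q (u + v) = Q u + Q v) {c F H : α → ℝ≥0∞} (hF : Q F + c = F)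
    (hH : Q H + F ≤ H) (hHtop : ∀ a, H a ≠ ∞) (a : α) :
    ∑' k, Q^[k] c a = F a := by
  -- In `ℝ≥0∞` an inequality is a sum with a remainder, so additivity alone gives monotonicity.
  have hmono : Monotone Q := fun u v huv => by
    obtain ⟨w, rfl⟩ := exists_add_of_le huv
    rw [hadd]
    exact le_self_add
  have haddk (k : ℕ) (u v : α → ℝ≥0∞) : Q^[k] (u + v) = Q^[k] u + Q^[k] v := by
    induction k generalizing u v with
    | zero => rfl
    | succ k ih => rw [Function.iterate_succ_apply, hadd, ih]; rfl
  have hsumH (k : ℕ) : Q^[k] H a + ∑ j ∈ Finset.range k, Q^[j] F a ≤ H a := by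
    induction k with
    | zero => simp
    | succ k ih =>
      refine le_trans ?_ ih
      have h := (hmono.iterate k) hH a
      rw [haddk, Pi.add_apply, ← Function.iterate_succ_apply] at h
      rw [Finset.sum_range_succ, add_comm (∑ j ∈ _, _), ← add_assoc]
      gcongr
  have hsumF (k : ℕ) : Q^[k] F a + ∑ j ∈ Finset.range k, Q^[j] c a = F a := by
    induction k with
    | zero => simp
    | succ k ih =>
      have h := congrFun (congrArg Q^[k] hF) a
      rw [haddk, Pi.add_apply, ← Function.iterate_succ_apply] at h
      rw [Finset.sum_range_succ, add_comm (∑ j ∈ _, _), ← add_assoc, h, ih]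
  have hfin : ∑' k, Q^[k] F a ≠ ∞ :=
    ne_top_of_le_ne_top (hHtop a) (ENNReal.tsum_le_of_sum_range_le fun k =>
      le_add_self.trans (hsumH k))
  have hlim := (ENNReal.tendsto_atTop_zero_of_tsum_ne_top hfin).add
    (ENNReal.tendsto_nat_tsum fun k => Q^[k] c a)
  simp_rw [hsumF, zero_add] at hlim
  exact tendsto_nhds_unique hlim tendsto_const_nhds

/-! ### Event rates and work conservation -/

section Rates

variable {ι : Type*} [Fintype ι]

theorem sum_event {M : Type*} [AddCommMonoid M] (f : Event ι → M) :
    ∑ e, f e = ∑ i, f (.arrival i) + ∑ i, f (.departure i) := by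
  let e : ι ⊕ ι ≃ Event ι :=
    { toFun := Sum.elim .arrival .departure
      invFun := fun x => match x with
        | .arrival i => .inl i
        | .departure i => .inr i
      left_inv := by rintro (i | i) <;> rfl
      right_inv := by rintro (i | i) <;> rfl }
  rw [← e.sum_comp, Fintype.sum_sum_type]
  rfl

theorem sum_mul_pos {b : ι → ℝ} (hb : ∀ i, 0 < b i) {n : ι → ℕ} (hn : n ≠ 0) :
    0 < ∑ j, (n j : ℝ) * b j := by
  obtain ⟨i, hi⟩ := Function.ne_iff.1 hn
  refine Finset.sum_pos' (fun j _ => mul_nonneg (Nat.cast_nonneg _) (hb j).le)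
    ⟨i, Finset.mem_univ _, mul_pos (Nat.cast_pos.2 (Nat.pos_of_ne_zero hi)) (hb i)⟩

theorem share_nonneg {b : ι → ℝ} (hb : ∀ i, 0 < b i) (n : ι → ℕ) (i : ι) : 0 ≤ share b n i :=
  div_nonneg (hb i).le (Finset.sum_nonneg fun j _ => mul_nonneg (Nat.cast_nonneg _) (hb j).le)

theorem sum_departure_rate {b : ι → ℝ} (hb : ∀ i, 0 < b i) (mu : ℝ) {n : ι → ℕ} (hn : n ≠ 0) :
    ∑ i, (n i : ℝ) * (mu * share b n i) = mu := by
  have h := (sum_mul_pos hb hn).ne'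
  have : ∀ i, (n i : ℝ) * (mu * share b n i) = mu * (((n i : ℝ) * b i) / ∑ j, (n j : ℝ) * b j) :=
    fun i => by rw [share]; ring
  simp_rw [this]
  rw [← Finset.mul_sum, ← Finset.sum_div, div_self h, mul_one]

theorem sum_ofReal_departure_rate {b : ι → ℝ} (hb : ∀ i, 0 < b i) {mu : ℝ} (hmu : 0 < mu)
    {n : ι → ℕ} (hn : n ≠ 0) :
    ∑ i, ENNReal.ofReal ((n i : ℝ) * (mu * share b n i)) = ENNReal.ofReal mu := by
  rw [← ENNReal.ofReal_sum_of_nonneg, sum_departure_rate hb mu hn]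
  exact fun i _ => mul_nonneg (Nat.cast_nonneg _) (mul_nonneg hmu.le (share_nonneg hb n i))

/-- In a nonempty state the capacity shares sum to one, and all classes have the same `mu`, so the
departure rates add up to `mu` whatever the priorities. -/
theorem totalRate_eq {lam b : ι → ℝ} {mu : ℝ} (hlam : ∀ i, 0 ≤ lam i) (hb : ∀ i, 0 < b i)
    (hmu : 0 < mu) {n : ι → ℕ} (hn : n ≠ 0) :
    totalRate lam b mu n = ENNReal.ofReal (∑ i, lam i + mu) := by
  rw [totalRate, sum_event, ENNReal.ofReal_add (Finset.sum_nonneg fun i _ => hlam i) hmu.le,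
    ENNReal.ofReal_sum_of_nonneg fun i _ => hlam i, ← sum_ofReal_departure_rate hb hmu hn]
  rfl

theorem totalRate_le {lam b : ι → ℝ} {mu : ℝ} (hlam : ∀ i, 0 ≤ lam i) (hb : ∀ i, 0 < b i)
    (hmu : 0 < mu) (n : ι → ℕ) :
    totalRate lam b mu n ≤ ENNReal.ofReal (∑ i, lam i + mu) := by
  rcases eq_or_ne n 0 with rfl | hn
  · rw [totalRate, sum_event, ENNReal.ofReal_add (Finset.sum_nonneg fun i _ => hlam i) hmu.le,
      ENNReal.ofReal_sum_of_nonneg fun i _ => hlam i]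
    simp [Event.rate]
  · exact (totalRate_eq hlam hb hmu hn).le

end Rates

/-! ### The jump chain seen by the tagged job -/

section Tagged

variable {ι : Type*} {lam b : ι → ℝ} {mu β : ℝ}

theorem taggedState_ne_zero (n : ι → ℕ) : taggedState n ≠ 0 :=
  fun h => one_ne_zero (congrFun h none)

theorem update_taggedState [DecidableEq ι] (n : ι → ℕ) (i : ι) (k : ℕ) :
    Function.update (taggedState n) (some i) k = taggedState (Function.update n i k) := by
  ext (_ | j)
  · simp [taggedState]
  · by_cases h : j = i
    · subst h; simp [taggedState]
    · simp [taggedState, h]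

theorem taggedRates_nonneg (hlam : ∀ i, 0 < lam i) (i : Option ι) : 0 ≤ taggedRates lam i := by
  cases i with
  | none => exact le_rfl
  | some i => exact (hlam i).le

theorem taggedPrio_pos (hb : ∀ i, 0 < b i) (hβ : 0 < β) (i : Option ι) : 0 < taggedPrio b β i := by
  cases i with
  | none => exact hβ
  | some i => exact hb i

variable [Fintype ι]

/-- The rate of the class `i` departures when the tagged job is present. -/
noncomputable def taggedDeparture (b : ι → ℝ) (mu β : ℝ) (n : ι → ℕ) (i : ι) : ℝ :=
  n i * (mu * (b i / (β + ∑ j, (n j : ℝ) * b j)))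

theorem taggedDeparture_nonneg (hb : ∀ i, 0 < b i) (hmu : 0 < mu) (hβ : 0 < β) (n : ι → ℕ)
    (i : ι) : 0 ≤ taggedDeparture b mu β n i := by
  have : 0 ≤ ∑ j, (n j : ℝ) * b j :=
    Finset.sum_nonneg fun j _ => mul_nonneg (Nat.cast_nonneg _) (hb j).le
  have := (hb i).le
  unfold taggedDeparture
  positivity

theorem totalRate_taggedState (hlam : ∀ i, 0 < lam i) (hb : ∀ i, 0 < b i) (hmu : 0 < mu)
    (hβ : 0 < β) (n : ι → ℕ) :
    totalRate (taggedRates lam) (taggedPrio b β) mu (taggedState n) =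
      ENNReal.ofReal (∑ i, lam i + mu) := by
  rw [totalRate_eq (taggedRates_nonneg hlam) (taggedPrio_pos hb hβ) hmu (taggedState_ne_zero n),
    Fintype.sum_option]
  simp [taggedRates]

variable [DecidableEq ι]

/-- One step of the jump chain in the presence of the tagged job, killed when the tagged job
leaves, acting on functions of the state of the other jobs. -/
noncomputable def taggedStep (lam b : ι → ℝ) (mu β : ℝ) (u : (ι → ℕ) → ℝ≥0∞) (n : ι → ℕ) : ℝ≥0∞ :=
  (ENNReal.ofReal (∑ i, lam i + mu))⁻¹ *
    (∑ i, ENNReal.ofReal (lam i) * u (Function.update n i (n i + 1)) +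
      ∑ i, ENNReal.ofReal (taggedDeparture b mu β n i) * u (Function.update n i (n i - 1)))

theorem taggedStep_add (lam b : ι → ℝ) (mu β : ℝ) (u v : (ι → ℕ) → ℝ≥0∞) :
    taggedStep lam b mu β (u + v) = taggedStep lam b mu β u + taggedStep lam b mu β v := by
  ext n
  simp only [taggedStep, Pi.add_apply, mul_add, Finset.sum_add_distrib]
  ring

/-- Class `none` has no arrivals and its departure is the killing event; every other event leads to
a tagged state again. -/
theorem killedStep_taggedState (hlam : ∀ i, 0 < lam i) (hb : ∀ i, 0 < b i) (hmu : 0 < mu)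
    (hβ : 0 < β) (g : (Option ι → ℕ) → ℝ≥0∞) :
    killedStep (taggedRates lam) (taggedPrio b β) mu none g ∘ taggedState =
      taggedStep lam b mu β (g ∘ taggedState) := by
  ext n
  have htot := totalRate_taggedState hlam hb hmu hβ n
  have hpos : 0 < ∑ i, lam i + mu := add_pos_of_nonneg_of_pos
    (Finset.sum_nonneg fun i _ => (hlam i).le) hmu
  have h0 : totalRate (taggedRates lam) (taggedPrio b β) mu (taggedState n) ≠ 0 := by
    rw [htot]; simpa using hpos
  have hstep : stepKernel (taggedRates lam) (taggedPrio b β) mu (taggedState n) =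
      ∑ e : Event (Option ι), (e.rate (taggedRates lam) (taggedPrio b β) mu (taggedState n) /
        totalRate (taggedRates lam) (taggedPrio b β) mu (taggedState n)) •
          Measure.dirac (e.next (taggedState n)) := if_neg h0
  rw [Function.comp_apply, killedStep, hstep, lintegral_finsetSum_measure, htot, sum_event,
    Fintype.sum_option, Fintype.sum_option]
  simp_rw [lintegral_smul_measure, lintegral_dirac]
  simp only [Event.rate, Event.next, update_taggedState, taggedStep, mul_add, Finset.mul_sum]
  simp [taggedRates, taggedPrio, taggedState, share, Fintype.sum_option, taggedDeparture,
    ENNReal.div_eq_inv_mul, mul_assoc]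

theorem taggedStep_ofReal (hlam : ∀ i, 0 < lam i) (hb : ∀ i, 0 < b i) (hmu : 0 < mu)
    (hβ : 0 < β) {f : (ι → ℕ) → ℝ} (hf : ∀ n, 0 ≤ f n) (n : ι → ℕ) :
    taggedStep lam b mu β (fun n => ENNReal.ofReal (f n)) n =
      ENNReal.ofReal ((∑ i, lam i + mu)⁻¹ * (∑ i, lam i * f (Function.update n i (n i + 1)) +
        ∑ i, taggedDeparture b mu β n i * f (Function.update n i (n i - 1)))) := by
  have hd := taggedDeparture_nonneg hb hmu hβ n
  have hpos : 0 < ∑ i, lam i + mu := add_pos_of_nonneg_of_pos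
    (Finset.sum_nonneg fun i _ => (hlam i).le) hmu
  have h1 (i : ι) : 0 ≤ lam i * f (Function.update n i (n i + 1)) :=
    mul_nonneg (hlam i).le (hf _)
  have h2 (i : ι) : 0 ≤ taggedDeparture b mu β n i * f (Function.update n i (n i - 1)) :=
    mul_nonneg (hd i) (hf _)
  rw [taggedStep, ENNReal.ofReal_mul (inv_nonneg.2 hpos.le), ENNReal.ofReal_inv_of_pos hpos,
    ENNReal.ofReal_add (Finset.sum_nonneg fun i _ => h1 i) (Finset.sum_nonneg fun i _ => h2 i),
    ENNReal.ofReal_sum_of_nonneg fun i _ => h1 i, ENNReal.ofReal_sum_of_nonneg fun i _ => h2 i]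
  simp only [ENNReal.ofReal_mul (hlam _).le, ENNReal.ofReal_mul (hd _)]

end Tagged

/-! ### The affine solution and its identification with the potential -/

section Potential

variable {ι : Type*} [Fintype ι]

theorem U₀_denom_pos {lam b : ι → ℝ} {mu β : ℝ} (hlam : ∀ i, 0 < lam i) (hb : ∀ i, 0 < b i)
    (hβ : 0 < β) (hstable : ∑ i, lam i < mu) : 0 < mu - ∑ i, lam i * b i / (b i + β) := by
  have : ∑ i, lam i * b i / (b i + β) ≤ ∑ i, lam i := Finset.sum_le_sum fun i _ => by
    have := hb i
    rw [div_le_iff₀ (by positivity)]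
    nlinarith [mul_pos (hlam i) hβ]
  linarith

theorem U_nonneg {lam b : ι → ℝ} {mu β : ℝ} (hb : ∀ i, 0 < b i) (hβ : 0 < β)
    (hU : 0 < U₀ lam b mu β) (i : ι) : 0 ≤ U lam b mu β i := by
  have := hb i
  unfold U
  positivity

/-- The amount missing from `mu` is the completion rate of the tagged job itself. -/
theorem sum_taggedDeparture {b : ι → ℝ} {mu β : ℝ} (hb : ∀ i, 0 < b i) (hβ : 0 < β) (n : ι → ℕ) :
    ∑ i, taggedDeparture b mu β n i = mu - mu * β / (β + ∑ j, (n j : ℝ) * b j) := by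
  have h0 : 0 ≤ ∑ j, (n j : ℝ) * b j :=
    Finset.sum_nonneg fun j _ => mul_nonneg (Nat.cast_nonneg _) (hb j).le
  have hD : β + ∑ j, (n j : ℝ) * b j ≠ 0 := by positivity
  have h (i : ι) : taggedDeparture b mu β n i =
      mu / (β + ∑ j, (n j : ℝ) * b j) * (n i * b i) := by
    unfold taggedDeparture; ring
  simp_rw [h, ← Finset.mul_sum]
  field_simp
  ring

theorem sum_taggedDeparture_le {b : ι → ℝ} {mu β : ℝ} (hb : ∀ i, 0 < b i) (hmu : 0 < mu)
    (hβ : 0 < β) (n : ι → ℕ) : ∑ i, taggedDeparture b mu β n i ≤ mu := by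
  have h0 : 0 ≤ ∑ j, (n j : ℝ) * b j :=
    Finset.sum_nonneg fun j _ => mul_nonneg (Nat.cast_nonneg _) (hb j).le
  rw [sum_taggedDeparture hb hβ]
  have : 0 ≤ mu * β / (β + ∑ j, (n j : ℝ) * b j) := by positivity
  linarith

/-- The expected remaining processing time of the tagged job in the presence of `n i` jobs of
class `i`. -/
noncomputable def conditionalTime (lam b : ι → ℝ) (mu β : ℝ) (n : ι → ℕ) : ℝ :=
  U₀ lam b mu β + ∑ i, U lam b mu β i * n i

theorem tsum_mul_ofReal_conditionalTime {lam b : ι → ℝ} {mu β : ℝ} (hb : ∀ i, 0 < b i)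
    (hβ : 0 < β) (hU₀ : 0 < U₀ lam b mu β) (π : PMF (ι → ℕ)) :
    ∑' n, π n * ENNReal.ofReal (conditionalTime lam b mu β n) =
      ENNReal.ofReal (U₀ lam b mu β) +
        ∑ i, ENNReal.ofReal (U lam b mu β i) * meanNumber π i := by
  have hU := U_nonneg hb hβ hU₀
  have h (n : ι → ℕ) : π n * ENNReal.ofReal (conditionalTime lam b mu β n) =
      π n * ENNReal.ofReal (U₀ lam b mu β) +
        ∑ i, ENNReal.ofReal (U lam b mu β i) * (π n * (n i : ℝ≥0∞)) := by
    have h1 (i : ι) : 0 ≤ U lam b mu β i * (n i : ℝ) := mul_nonneg (hU i) (Nat.cast_nonneg _)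
    rw [conditionalTime, ENNReal.ofReal_add hU₀.le (Finset.sum_nonneg fun i _ => h1 i),
      ENNReal.ofReal_sum_of_nonneg fun i _ => h1 i, mul_add, Finset.mul_sum]
    congr 1
    refine Finset.sum_congr rfl fun i _ => ?_
    rw [ENNReal.ofReal_mul (hU i), ENNReal.ofReal_natCast]
    ring
  simp_rw [h]
  rw [ENNReal.tsum_add, ENNReal.tsum_mul_right, π.tsum_coe, one_mul,
    Summable.tsum_finsetSum fun _ _ => ENNReal.summable]
  simp_rw [ENNReal.tsum_mul_left]
  rfl

variable [DecidableEq ι]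

theorem sum_mul_update (u : ι → ℝ) (n : ι → ℕ) (i : ι) (k : ℕ) :
    ∑ j, u j * (Function.update n i k j : ℝ) = ∑ j, u j * (n j : ℝ) + u i * (k - n i) := by
  have h (j : ι) : u j * (Function.update n i k j : ℝ) =
      u j * (n j : ℝ) + if j = i then u i * (k - n i) else 0 := by
    by_cases h : j = i
    · subst h; simp; ring
    · simp [h]
  simp_rw [h, Finset.sum_add_distrib]
  simp

/-- Truncated subtraction at `n i = 0` is harmless because the departure rate vanishes there. -/
theorem taggedDeparture_mul_update {b : ι → ℝ} {mu β : ℝ} (n : ι → ℕ) (i : ι) (u : ι → ℝ)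
    (φ : ℝ → ℝ) :
    taggedDeparture b mu β n i * φ (∑ j, u j * (Function.update n i (n i - 1) j : ℝ)) =
      taggedDeparture b mu β n i * φ (∑ j, u j * (n j : ℝ) - u i) := by
  rcases Nat.eq_zero_or_pos (n i) with h | h
  · simp [taggedDeparture, h]
  · rw [sum_mul_update, Nat.cast_sub h]
    congr 2
    push_cast
    ring

theorem conditionalTime_eq {lam b : ι → ℝ} {mu β : ℝ} (hlam : ∀ i, 0 < lam i)
    (hb : ∀ i, 0 < b i) (hmu : 0 < mu) (hβ : 0 < β) (hstable : ∑ i, lam i < mu) (n : ι → ℕ) :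
    (∑ i, lam i + mu)⁻¹ *
      (∑ i, lam i * conditionalTime lam b mu β (Function.update n i (n i + 1)) +
        ∑ i, taggedDeparture b mu β n i *
          conditionalTime lam b mu β (Function.update n i (n i - 1))) + (∑ i, lam i + mu)⁻¹ =
      conditionalTime lam b mu β n := by
  have hpos : 0 < ∑ i, lam i + mu := add_pos_of_nonneg_of_pos
    (Finset.sum_nonneg fun i _ => (hlam i).le) hmu
  have h0 : 0 ≤ ∑ j, (n j : ℝ) * b j :=
    Finset.sum_nonneg fun j _ => mul_nonneg (Nat.cast_nonneg _) (hb j).le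
  have hD : 0 < β + ∑ j, (n j : ℝ) * b j := by positivity
  have hdenom := U₀_denom_pos hlam hb hβ hstable
  have hup (i : ι) : lam i * conditionalTime lam b mu β (Function.update n i (n i + 1)) =
      lam i * conditionalTime lam b mu β n + lam i * U lam b mu β i := by
    rw [conditionalTime, sum_mul_update, conditionalTime]
    push_cast
    ring
  have hdown (i : ι) : taggedDeparture b mu β n i *
      conditionalTime lam b mu β (Function.update n i (n i - 1)) =
      taggedDeparture b mu β n i * conditionalTime lam b mu β n -
        taggedDeparture b mu β n i * U lam b mu β i := by
    rw [conditionalTime, taggedDeparture_mul_update n i _ fun y => U₀ lam b mu β + y,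
      conditionalTime]
    ring
  -- This is the defining equation of `U₀`; it balances the constant terms.
  have hlamU : ∑ i, lam i * U lam b mu β i = mu * U₀ lam b mu β - 1 := by
    have h1 : (mu - ∑ i, lam i * b i / (b i + β)) * U₀ lam b mu β = 1 :=
      mul_inv_cancel₀ hdenom.ne'
    have h2 : ∑ i, lam i * U lam b mu β i =
        (∑ i, lam i * b i / (b i + β)) * U₀ lam b mu β := by
      rw [Finset.sum_mul]
      exact Finset.sum_congr rfl fun i _ => by rw [U]; ring
    rw [h2]
    linarith
  -- By `(b i + β) U_i = b i U₀`, departures of the others produce a multiple of `conditionalTime`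
  -- that exactly offsets the killing rate in `sum_taggedDeparture`.
  have hdepU : ∑ i, taggedDeparture b mu β n i * U lam b mu β i =
      mu * U₀ lam b mu β -
        mu * β / (β + ∑ j, (n j : ℝ) * b j) * conditionalTime lam b mu β n := by
    have h1 (i : ι) : taggedDeparture b mu β n i * U lam b mu β i =
        mu / (β + ∑ j, (n j : ℝ) * b j) *
          (U₀ lam b mu β * (n i * b i) - β * (U lam b mu β i * n i)) := by
      have := hb i
      unfold taggedDeparture U
      field_simp
      ring
    simp_rw [h1, ← Finset.mul_sum, Finset.sum_sub_distrib, ← Finset.mul_sum]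
    rw [conditionalTime]
    field_simp
    ring
  simp_rw [hup, hdown, Finset.sum_add_distrib, Finset.sum_sub_distrib, ← Finset.sum_mul]
  rw [hlamU, hdepU, sum_taggedDeparture hb hβ]
  field_simp
  ring

theorem exists_lyapunov {lam b : ι → ℝ} {mu β : ℝ} (hlam : ∀ i, 0 < lam i)
    (hb : ∀ i, 0 < b i) (hmu : 0 < mu) (hβ : 0 < β) (hstable : ∑ i, lam i < mu) :
    ∃ h : (ι → ℕ) → ℝ, (∀ n, 0 ≤ h n) ∧ ∀ n, (∑ i, lam i + mu)⁻¹ *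
      (∑ i, lam i * h (Function.update n i (n i + 1)) +
        ∑ i, taggedDeparture b mu β n i * h (Function.update n i (n i - 1))) +
          conditionalTime lam b mu β n ≤ h n := by
  set L := ∑ i, lam i with hL
  have hL0 : 0 ≤ L := Finset.sum_nonneg fun i _ => (hlam i).le
  have hpos : 0 < L + mu := by positivity
  have hU₀ : 0 < U₀ lam b mu β := inv_pos.2 (U₀_denom_pos hlam hb hβ hstable)
  have hU := U_nonneg hb hβ hU₀
  set C := U₀ lam b mu β + ∑ i, U lam b mu β i with hC
  have hC0 : 0 ≤ C := add_nonneg hU₀.le (Finset.sum_nonneg fun i _ => hU i)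
  have hgap : 0 < mu - L := by linarith
  -- With `φ` below, `L φ(s+1) + mu φ(s-1) - (L+mu) φ(s)` equals `-2a(mu-L)(1+s) + a(L+mu) -
  -- c(mu-L)`. The choice of `a` makes the linear part `-(L+mu)C(1+s)`; the choice of `c` cancels
  -- the constant.
  obtain ⟨a, ha0, ha⟩ : ∃ a, 0 ≤ a ∧ 2 * a * (mu - L) = (L + mu) * C :=
    ⟨(L + mu) * C / (2 * (mu - L)), by positivity, by field_simp⟩
  obtain ⟨c, hc0, hc⟩ : ∃ c, 0 ≤ c ∧ c * (mu - L) = a * (L + mu) :=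
    ⟨a * (L + mu) / (mu - L), by positivity, by field_simp⟩
  set φ : ℝ → ℝ := fun s => a * (1 + s) ^ 2 + c * (1 + s) with hφ
  refine ⟨fun n => φ (∑ j, 1 * (n j : ℝ)), fun n => ?_, fun n => ?_⟩
  · have : 0 ≤ ∑ j, 1 * (n j : ℝ) := Finset.sum_nonneg fun j _ => by positivity
    simp only [hφ]
    positivity
  · have hs : 0 ≤ ∑ j, 1 * (n j : ℝ) := Finset.sum_nonneg fun j _ => by positivity
    have htime : conditionalTime lam b mu β n ≤ C * (1 + ∑ j, 1 * (n j : ℝ)) := by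
      have h1 : ∑ i, U lam b mu β i * n i ≤ (∑ i, U lam b mu β i) * ∑ j, 1 * (n j : ℝ) := by
        rw [Finset.sum_mul]
        refine Finset.sum_le_sum fun i _ => mul_le_mul_of_nonneg_left ?_ (hU i)
        simp_rw [one_mul]
        exact Finset.single_le_sum (f := fun j => (n j : ℝ)) (fun j _ => Nat.cast_nonneg _)
          (Finset.mem_univ i)
      have h2 : 0 ≤ ∑ i, U lam b mu β i := Finset.sum_nonneg fun i _ => hU i
      rw [conditionalTime, hC]
      nlinarith [mul_nonneg hU₀.le hs]
    have hd := sum_taggedDeparture_le hb hmu hβ n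
    simp_rw [taggedDeparture_mul_update n _ (fun _ => 1) φ, sum_mul_update]
    set s := ∑ j, 1 * (n j : ℝ)
    have hup (i : ι) : lam i * φ (s + 1 * (((n i + 1 : ℕ) : ℝ) - n i)) = lam i * φ (s + 1) := by
      push_cast
      ring_nf
    simp_rw [hup, ← Finset.sum_mul]
    rw [← hL]
    -- Nonnegativity allows the total departure rate to be replaced by its upper bound `mu`. The
    -- shift by `1` in `φ` makes this hold at `s = 0` too.
    have hφ0 : 0 ≤ φ (s - 1) := by
      simp only [hφ]
      have : 0 ≤ 1 + (s - 1) := by linarith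
      positivity
    have h1 : L * φ (s + 1) + (∑ i, taggedDeparture b mu β n i) * φ (s - 1) ≤
        (L + mu) * (φ s - C * (1 + s)) := by
      refine (add_le_add_right (mul_le_mul_of_nonneg_right hd hφ0) _).trans (le_of_eq ?_)
      simp only [hφ]
      linear_combination (-(1 + s)) * ha - hc
    have h2 : (L + mu)⁻¹ * (L * φ (s + 1) + (∑ i, taggedDeparture b mu β n i) * φ (s - 1)) ≤
        φ s - C * (1 + s) := by
      rwa [inv_mul_le_iff₀ hpos]
    linarith

theorem tsum_iterate_taggedStep {lam b : ι → ℝ} {mu β : ℝ} (hlam : ∀ i, 0 < lam i)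
    (hb : ∀ i, 0 < b i) (hmu : 0 < mu) (hβ : 0 < β) (hstable : ∑ i, lam i < mu) (n : ι → ℕ) :
    ∑' k, (taggedStep lam b mu β)^[k] (fun _ => (ENNReal.ofReal (∑ i, lam i + mu))⁻¹) n =
      ENNReal.ofReal (conditionalTime lam b mu β n) := by
  have hpos : 0 < ∑ i, lam i + mu := add_pos_of_nonneg_of_pos
    (Finset.sum_nonneg fun i _ => (hlam i).le) hmu
  have hU₀ : 0 < U₀ lam b mu β := inv_pos.2 (U₀_denom_pos hlam hb hβ hstable)
  have hU := U_nonneg hb hβ hU₀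
  have htime (n : ι → ℕ) : 0 ≤ conditionalTime lam b mu β n :=
    add_nonneg hU₀.le (Finset.sum_nonneg fun i _ => mul_nonneg (hU i) (Nat.cast_nonneg _))
  have hd := taggedDeparture_nonneg hb hmu hβ
  obtain ⟨h, h0, hh⟩ := exists_lyapunov hlam hb hmu hβ hstable
  have hnn {f : (ι → ℕ) → ℝ} (hf : ∀ n, 0 ≤ f n) (n : ι → ℕ) : 0 ≤ (∑ i, lam i + mu)⁻¹ *
      (∑ i, lam i * f (Function.update n i (n i + 1)) +
        ∑ i, taggedDeparture b mu β n i * f (Function.update n i (n i - 1))) :=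
    mul_nonneg (inv_nonneg.2 hpos.le) (add_nonneg
      (Finset.sum_nonneg fun i _ => mul_nonneg (hlam i).le (hf _))
      (Finset.sum_nonneg fun i _ => mul_nonneg (hd n i) (hf _)))
  refine tsum_iterate_eq_of_lyapunov (taggedStep_add lam b mu β)
    (F := fun n => ENNReal.ofReal (conditionalTime lam b mu β n))
    (H := fun n => ENNReal.ofReal (h n)) ?_ ?_ (fun _ => ENNReal.ofReal_ne_top) n
  · ext n
    rw [Pi.add_apply, taggedStep_ofReal hlam hb hmu hβ htime, ← ENNReal.ofReal_inv_of_pos hpos,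
      ← ENNReal.ofReal_add (hnn htime n) (inv_nonneg.2 hpos.le),
      conditionalTime_eq hlam hb hmu hβ hstable]
  · intro n
    rw [Pi.add_apply, taggedStep_ofReal hlam hb hmu hβ h0, ← ENNReal.ofReal_add (hnn h0 n) (htime n)]
    exact ENNReal.ofReal_le_ofReal (hh n)

/-- Stationarity plays no role here: any initial law with finite means will do. Finiteness supplies
the summability required by `lintegral_emptyTime`. -/
theorem expectedProcessingTime_eq {lam b : ι → ℝ} {mu β : ℝ} (hlam : ∀ i, 0 < lam i)
    (hb : ∀ i, 0 < b i) (hmu : 0 < mu) (hβ : 0 < β) (hstable : ∑ i, lam i < mu)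
    (π : PMF (ι → ℕ)) (hmean : ∀ i, meanNumber π i ≠ ∞) :
    expectedProcessingTime lam b mu π β =
      ENNReal.ofReal (U₀ lam b mu β) +
        ∑ i, ENNReal.ofReal (U lam b mu β i) * meanNumber π i := by
  have hU₀ : 0 < U₀ lam b mu β := inv_pos.2 (U₀_denom_pos hlam hb hβ hstable)
  have hpos : 0 < ∑ i, lam i + mu := add_pos_of_nonneg_of_pos
    (Finset.sum_nonneg fun i _ => (hlam i).le) hmu
  have hsum : ∑' k, ∫⁻ n, {n : Option ι → ℕ | n none ≠ 0}.indicator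
      ((killedStep (taggedRates lam) (taggedPrio b β) mu none)^[k] fun n =>
        (totalRate (taggedRates lam) (taggedPrio b β) mu n)⁻¹) n
          ∂((π.map taggedState).toMeasure) =
      ENNReal.ofReal (U₀ lam b mu β) +
        ∑ i, ENNReal.ofReal (U lam b mu β i) * meanNumber π i := by
    rw [← tsum_mul_ofReal_conditionalTime hb hβ hU₀ π]
    simp_rw [← tsum_iterate_taggedStep hlam hb hmu hβ hstable, ← ENNReal.tsum_mul_left]
    rw [ENNReal.tsum_comm]
    refine tsum_congr fun k => ?_
    rw [← PMF.toMeasure_map _ _ (Measurable.of_discrete),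
      lintegral_map (Measurable.of_discrete) (Measurable.of_discrete), lintegral_countable']
    refine tsum_congr fun n => ?_
    rw [PMF.toMeasure_apply_singleton _ _ (measurableSet_singleton n), mul_comm]
    congr 1
    have hiter := Function.Semiconj.iterate_right (f := fun g : (Option ι → ℕ) → ℝ≥0∞ =>
      g ∘ taggedState) (killedStep_taggedState hlam hb hmu hβ) k
    have hone : taggedState n none ≠ 0 := one_ne_zero
    rw [Set.indicator_of_mem (by exact hone)]
    refine (congrFun (hiter _) n).trans ?_
    refine congrArg (fun u => (taggedStep lam b mu β)^[k] u n) (funext fun m => ?_)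
    exact congrArg Inv.inv (totalRate_taggedState hlam hb hmu hβ m)
  rw [expectedProcessingTime, ← hsum]
  refine lintegral_emptyTime _ _ _ _ _ (ENNReal.ofReal_ne_zero_iff.2 ?_)
    (ENNReal.ofReal_ne_top) (totalRate_le (taggedRates_nonneg hlam) (taggedPrio_pos hb hβ) hmu) ?_
  · rw [Fintype.sum_option]
    simpa [taggedRates] using hpos
  · rw [hsum]
    exact ENNReal.add_ne_top.2 ⟨ENNReal.ofReal_ne_top, ENNReal.sum_ne_top.2 fun i _ =>
      ENNReal.mul_ne_top ENNReal.ofReal_ne_top (hmean i)⟩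

end Potential

/-! ### Geometric tail of the total number of jobs -/

section Stationary

variable {ι : Type*} [Fintype ι]

/-- The probability of at least `k` jobs in the system. -/
noncomputable def tailProb (π : PMF (ι → ℕ)) (k : ℕ) : ℝ≥0∞ :=
  ∑' n, π n * if k ≤ ∑ i, n i then 1 else 0

theorem tailProb_zero (π : PMF (ι → ℕ)) : tailProb π 0 = 1 := by
  simp [tailProb, π.tsum_coe]

theorem tailProb_ne_top (π : PMF (ι → ℕ)) (k : ℕ) : tailProb π k ≠ ∞ := by
  refine ne_top_of_le_ne_top ENNReal.one_ne_top (le_of_le_of_eq ?_ π.tsum_coe)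
  exact ENNReal.tsum_le_tsum fun n => by split_ifs <;> simp

theorem tailProb_eq_toMeasure (π : PMF (ι → ℕ)) (k : ℕ) :
    tailProb π k = π.toMeasure {n | k ≤ ∑ i, n i} := by
  rw [PMF.toMeasure_apply (hs := .of_discrete)]
  exact tsum_congr fun n => by by_cases h : k ≤ ∑ i, n i <;> simp [h]

theorem tendsto_tailProb (π : PMF (ι → ℕ)) :
    Filter.Tendsto (tailProb π) Filter.atTop (nhds 0) := by
  have h := tendsto_measure_iInter_atTop (μ := π.toMeasure)
    (s := fun k : ℕ => {n : ι → ℕ | k ≤ ∑ i, n i})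
    (fun k => (MeasurableSet.of_discrete).nullMeasurableSet)
    (fun k l hkl n hn => hkl.trans hn) ⟨0, measure_ne_top _ _⟩
  have hempty : ⋂ k : ℕ, {n : ι → ℕ | k ≤ ∑ i, n i} = ∅ := by
    ext n
    simp only [Set.mem_iInter, Set.mem_ofPred_eq, Set.mem_empty_iff_false, iff_false, not_forall]
    exact ⟨∑ i, n i + 1, by simp⟩
  rw [hempty, measure_empty] at h
  exact h.congr fun k => (tailProb_eq_toMeasure π k).symm

theorem meanNumber_le_tsum_tailProb (π : PMF (ι → ℕ)) (i : ι) :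
    meanNumber π i ≤ ∑' k, tailProb π (k + 1) := by
  unfold meanNumber tailProb
  rw [ENNReal.tsum_comm]
  refine ENNReal.tsum_le_tsum fun n => ?_
  rw [ENNReal.tsum_mul_left]
  gcongr
  have h : ∑ k ∈ Finset.range (n i), (1 : ℝ≥0∞) ≤
      ∑' k, if k + 1 ≤ ∑ j, n j then (1 : ℝ≥0∞) else 0 := by
    refine le_trans (Finset.sum_le_sum fun k hk => ?_) (ENNReal.sum_le_tsum (Finset.range (n i)))
    have h1 : n i ≤ ∑ j, n j := Finset.single_le_sum (fun j _ => Nat.zero_le _) (Finset.mem_univ i)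
    rw [if_pos ((Nat.succ_le_of_lt (Finset.mem_range.1 hk)).trans h1)]
  simpa using h

variable [DecidableEq ι] {lam b : ι → ℝ} {mu : ℝ}

/-- Global balance integrated against a test function; with values in `ℝ≥0∞` the sums may be
exchanged freely. -/
theorem IsSteadyState.tsum_mul_test {π : PMF (ι → ℕ)} (hπ : IsSteadyState lam b mu π)
    (φ : (ι → ℕ) → ℝ≥0∞) :
    ∑' n, π n * ∑ e : Event ι, e.rate lam b mu n * φ (e.next n) =
      ∑' n, π n * (totalRate lam b mu n * φ n) := by
  have h (m : ι → ℕ) : π m * (totalRate lam b mu m * φ m) =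
      ∑' n, π n * (transRate lam b mu n m * φ m) := by
    simp_rw [← mul_assoc, ENNReal.tsum_mul_right]
    rw [hπ m]
  simp_rw [h]
  rw [ENNReal.tsum_comm]
  refine tsum_congr fun n => ?_
  rw [ENNReal.tsum_mul_left]
  congr 1
  simp_rw [transRate, Finset.sum_mul]
  rw [Summable.tsum_finsetSum fun _ _ => ENNReal.summable]
  refine Finset.sum_congr rfl fun e _ => ?_
  rw [tsum_eq_single (e.next n) fun m hm => by rw [if_neg hm.symm, zero_mul], if_pos rfl]

theorem sum_update (n : ι → ℕ) (i : ι) (k : ℕ) :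
    ∑ j, Function.update n i k j + n i = ∑ j, n j + k := by
  rw [Finset.sum_update_of_mem (Finset.mem_univ i), ← Finset.sum_sdiff
    (Finset.subset_univ {i} : {i} ⊆ (Finset.univ : Finset ι)), Finset.sum_singleton]
  omega

theorem sum_rate_mul_tail (hlam : ∀ i, 0 ≤ lam i) (hb : ∀ i, 0 < b i) (hmu : 0 < mu)
    (n : ι → ℕ) (k : ℕ) :
    ∑ e : Event ι, e.rate lam b mu n * (if k + 1 ≤ ∑ j, e.next n j then 1 else 0) =
      ENNReal.ofReal (∑ i, lam i) * (if k ≤ ∑ j, n j then 1 else 0) +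
        ENNReal.ofReal mu * (if k + 2 ≤ ∑ j, n j then 1 else 0) := by
  rw [sum_event, ENNReal.ofReal_sum_of_nonneg fun i _ => hlam i, Finset.sum_mul]
  congr 1
  · refine Finset.sum_congr rfl fun i _ => ?_
    have h := sum_update n i (n i + 1)
    have h' : ∑ j, Function.update n i (n i + 1) j = ∑ j, n j + 1 := by omega
    simp only [Event.rate, Event.next, h', add_le_add_iff_right]
  · rcases eq_or_ne n 0 with rfl | hn
    · simp [Event.rate]
    · rw [← sum_ofReal_departure_rate hb hmu hn, Finset.sum_mul]
      refine Finset.sum_congr rfl fun i _ => ?_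
      rcases Nat.eq_zero_or_pos (n i) with h0 | h0
      · simp [Event.rate, h0]
      · have h := sum_update n i (n i - 1)
        have h' : (k + 1 ≤ ∑ j, Function.update n i (n i - 1) j) ↔ k + 2 ≤ ∑ j, n j := by omega
        simp only [Event.rate, Event.next, h']

theorem IsSteadyState.tailProb_rec {π : PMF (ι → ℕ)} (hπ : IsSteadyState lam b mu π)
    (hlam : ∀ i, 0 ≤ lam i) (hb : ∀ i, 0 < b i) (hmu : 0 < mu) (k : ℕ) :
    ENNReal.ofReal (∑ i, lam i) * tailProb π k + ENNReal.ofReal mu * tailProb π (k + 2) =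
      ENNReal.ofReal (∑ i, lam i + mu) * tailProb π (k + 1) := by
  have h := hπ.tsum_mul_test fun n => if k + 1 ≤ ∑ j, n j then 1 else 0
  simp_rw [sum_rate_mul_tail hlam hb hmu] at h
  -- The threshold `k + 1` excludes the empty state, the only one where the total rate may differ.
  have hr (n : ι → ℕ) :
      totalRate lam b mu n * (if k + 1 ≤ ∑ j, n j then 1 else 0) =
        ENNReal.ofReal (∑ i, lam i + mu) * (if k + 1 ≤ ∑ j, n j then 1 else 0) := by
    split_ifs with hk
    · rw [totalRate_eq hlam hb hmu]
      rintro rfl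
      simp at hk
    · simp
  simp_rw [hr, mul_add, ENNReal.tsum_add, mul_left_comm (π _), ENNReal.tsum_mul_left] at h
  exact h

/-- The recursion says that the net flow `L t_k - mu t_{k+1}` between adjacent levels does not
depend on `k`. The tails tend to zero, so it vanishes, leaving a geometric sequence. -/
theorem IsSteadyState.tailProb_eq {π : PMF (ι → ℕ)} (hπ : IsSteadyState lam b mu π)
    (hlam : ∀ i, 0 ≤ lam i) (hb : ∀ i, 0 < b i) (hmu : 0 < mu) (k : ℕ) :
    (tailProb π k).toReal = ((∑ i, lam i) / mu) ^ k := by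
  have hL : 0 ≤ ∑ i, lam i := Finset.sum_nonneg fun i _ => hlam i
  set L := ∑ i, lam i
  have hrec (k : ℕ) : L * (tailProb π k).toReal - mu * (tailProb π (k + 1)).toReal =
      L * (tailProb π (k + 1)).toReal - mu * (tailProb π (k + 1 + 1)).toReal := by
    have h := congrArg ENNReal.toReal (hπ.tailProb_rec hlam hb hmu k)
    rw [ENNReal.toReal_add (ENNReal.mul_ne_top ENNReal.ofReal_ne_top (tailProb_ne_top π _))
      (ENNReal.mul_ne_top ENNReal.ofReal_ne_top (tailProb_ne_top π _)), ENNReal.toReal_mul,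
      ENNReal.toReal_mul, ENNReal.toReal_mul, ENNReal.toReal_ofReal hL,
      ENNReal.toReal_ofReal hmu.le, ENNReal.toReal_ofReal (by positivity)] at h
    linarith
  have hconst (k : ℕ) : L * (tailProb π k).toReal - mu * (tailProb π (k + 1)).toReal =
      L * (tailProb π 0).toReal - mu * (tailProb π 1).toReal := by
    induction k with
    | zero => rfl
    | succ k ih => rw [← ih, ← hrec]
  have hlim : Filter.Tendsto (fun k => (tailProb π k).toReal) Filter.atTop (nhds 0) :=
    (ENNReal.tendsto_toReal ENNReal.zero_ne_top).comp (tendsto_tailProb π)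
  have hlim' := (hlim.const_mul L).sub ((hlim.comp (Filter.tendsto_add_atTop_nat 1)).const_mul mu)
  have hzero := tendsto_nhds_unique (hlim'.congr hconst) tendsto_const_nhds
  simp only [mul_zero, sub_zero] at hzero
  induction k with
  | zero => simp [tailProb_zero]
  | succ k ih =>
    have h := hconst k
    rw [← hzero, ih] at h
    rw [pow_succ, ← mul_right_inj' hmu.ne']
    field_simp
    field_simp at h
    linarith

theorem IsSteadyState.meanNumber_ne_top {π : PMF (ι → ℕ)} (hπ : IsSteadyState lam b mu π)
    (hlam : ∀ i, 0 ≤ lam i) (hb : ∀ i, 0 < b i) (hmu : 0 < mu) (hstable : ∑ i, lam i < mu)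
    (i : ι) : meanNumber π i ≠ ∞ := by
  refine ne_top_of_le_ne_top ?_ (meanNumber_le_tsum_tailProb π i)
  have hL : 0 ≤ ∑ i, lam i := Finset.sum_nonneg fun i _ => hlam i
  have hs : Summable fun k : ℕ => ((∑ i, lam i) / mu) ^ (k + 1) :=
    (summable_nat_add_iff 1).2
      (summable_geometric_of_lt_one (by positivity) ((div_lt_one hmu).2 hstable))
  have h (k : ℕ) : tailProb π (k + 1) = ENNReal.ofReal (((∑ i, lam i) / mu) ^ (k + 1)) := by
    rw [← hπ.tailProb_eq hlam hb hmu, ENNReal.ofReal_toReal (tailProb_ne_top π _)]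
  simp_rw [h]
  exact hs.tsum_ofReal_ne_top

end Stationary

end DPS

theorem theorem2 (K : ℕ) (lam b : Fin K → ℝ) (mu : ℝ)
    (hlam : ∀ i, 0 < lam i) (hb : ∀ i, 0 < b i) (hmu : 0 < mu)
    (hstable : ∑ i, lam i / mu < 1)
    (π : PMF (Fin K → ℕ)) (hπ : DPS.IsSteadyState lam b mu π)
    (β : ℝ) (hβ : 0 < β) :
    0 < mu - ∑ i, lam i * b i / (b i + β) ∧
    (∀ i, DPS.meanNumber π i ≠ ∞) ∧
    DPS.expectedProcessingTime lam b mu π β ≠ ∞ ∧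
    (DPS.expectedProcessingTime lam b mu π β).toReal =
      DPS.U₀ lam b mu β + ∑ i, DPS.U lam b mu β i * (DPS.meanNumber π i).toReal := by
  have hstable' : ∑ i, lam i < mu := by
    rwa [← Finset.sum_div, div_lt_one hmu] at hstable
  have hdenom := DPS.U₀_denom_pos hlam hb hβ hstable'
  have hU₀ : 0 < DPS.U₀ lam b mu β := inv_pos.2 hdenom
  have hmean := hπ.meanNumber_ne_top (fun i => (hlam i).le) hb hmu hstable'
  have hterm (i : Fin K) : ENNReal.ofReal (DPS.U lam b mu β i) * DPS.meanNumber π i ≠ ∞ :=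
    ENNReal.mul_ne_top ENNReal.ofReal_ne_top (hmean i)
  have hsum := ENNReal.sum_ne_top.2 fun i (_ : i ∈ Finset.univ) => hterm i
  rw [DPS.expectedProcessingTime_eq hlam hb hmu hβ hstable' π hmean]
  refine ⟨hdenom, hmean, ENNReal.add_ne_top.2 ⟨ENNReal.ofReal_ne_top, hsum⟩, ?_⟩
  rw [ENNReal.toReal_add ENNReal.ofReal_ne_top hsum, ENNReal.toReal_ofReal hU₀.le,
    ENNReal.toReal_sum fun i _ => hterm i]
  simp_rw [ENNReal.toReal_mul, ENNReal.toReal_ofReal (DPS.U_nonneg hb hβ hU₀ _)]
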